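/- **Theorem (lower bound for minima finding).** Write $[N]=\{0,\dots,N-1\}$. Consider the following three problems. 1. *Find $d$ smallest values of a function.* Given $f:[N]\to\mathbb N\cup\{\infty\}$, find $I\subseteq[N]$ with $|I|=d$ such that $f(i)\le f(j)$ for all $i\in I$ and $j\in[N]\setminus I$. 2. *Find $d$ elements of different type.* Given $g:[N]\to\mathbb N$ and an integer $d'$, let $e=|g([N])|$ be the number of types and $d=\min\{d',e\}$; find $I\subseteq[N]$ with $|I|=d$ such that $g(i)\ne g(i')$ for all distinct $i,i'\in I$. 3. *Find $d$ smallest values of different type.* Given $f:[N]\to\mathbb N\cup\{\infty\}$, $g:[N]\to\mathbb N$ and an integer $d'$, with $e$ and $d$ as in 2, find $I\subseteq[N]$ with $|I|=d$ such that $g(i)\ne g(i')$ for all distinct $i,i'\in I$, and such that for all $j\in[N]\setminus I$ and $i\in I$ with $f(j)<f(i)$ there is $i'\in I$ with $g(i')=g(j)$ and $f(i')\le f(j)$. A quantum algorithm with $T$ queries to an input $x:[N]\to\alpha$ (that is, $x=f$, $x=g$ and $x=(f,g)$ in the three problems) has a fixed initial unit vector in a Hilbert space with orthonormal basis $|q,a,w\rangle$,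 where $q\in[N]\cup\{\mathrm{none}\}$, $a$ belongs to an abelian group in which $\alpha$ is injectively encoded, and $w$ is an arbitrary workspace content. It applies $U_TO_xU_{T-1}O_x\cdots O_xU_0$ with input-independent unitaries $U_t$ and the query operator $O_x|i,a,w\rangle=|i,a+x(i),w\rangle$, $O_x|\mathrm{none},a,w\rangle=|\mathrm{none},a,w\rangle$. It then measures in this basis, and the output is a function of the measured basis state. For every error bound $0\le\varepsilon<1/2$ there is a constant $c>0$ such that, for all integers $N,d\ge 0$ with $d\le N/2$, the following hold. 1. Every quantum algorithm which for every $f$ solves Problem 1 with error probability at most $\varepsilon$ makes at least $c\sqrt{dN}$ queries. 2. If $d\ge2$, then for every $d'\ge d$, every quantum algorithm which for every $g$ with $\min\{d',e\}=d$ solves Problem 2 with error probability at most $\varepsilon$ makes at least $c\sqrt{dN}$ queries. 3. For every $d'\ge d$, every quantum algorithm which for every $(f,g)$ with $\min\{d',e\}=d$ solves Problem 3 with error probability at most $\varepsilon$ makes at least $c\sqrt{dN}$ queries. In short, the three problems have bounded-error quantum query complexity $\Omega(\sqrt{dN})$. -/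

import Mathlib

open scoped ENNReal

namespace QuantumQuery

noncomputable section

/-! ### Quantum query algorithms -/

/-- The Hilbert space `ℓ²(B)` with orthonormal basis `|b⟩`, `b ∈ B`. A state `ψ` has the
amplitude `ψ b` on the basis state `|b⟩`. -/
abbrev StateSpace (B : Type) : Type := lp (fun _ : B => ℂ) 2

/-- The unitary operator on `ℓ²(B)` that permutes the basis states, `|b⟩ ↦ |σ b⟩`. -/
def permUnitary {B : Type} (σ : B ≃ B) : StateSpace B ≃ₗᵢ[ℂ] StateSpace B where
  toFun ψ := ⟨fun b => ψ (σ.symm b), by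
    have h := (memℓp_gen_iff (p := 2) (by norm_num)).1 (lp.memℓp ψ)
    exact memℓp_gen ((Equiv.summable_iff σ.symm).2 h)⟩
  invFun ψ := ⟨fun b => ψ (σ b), by
    have h := (memℓp_gen_iff (p := 2) (by norm_num)).1 (lp.memℓp ψ)
    exact memℓp_gen ((Equiv.summable_iff σ).2 h)⟩
  left_inv ψ := by ext b; simp
  right_inv ψ := by ext b; simp
  map_add' ψ φ := by ext b; rfl
  map_smul' c ψ := by ext b; rfl
  norm_map' ψ := by
    rw [lp.norm_eq_tsum_rpow (by norm_num), lp.norm_eq_tsum_rpow (by norm_num)]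
    congr 1
    exact Equiv.tsum_eq σ.symm (fun b => ‖ψ b‖ ^ (2 : ℝ≥0∞).toReal)

@[simp]
theorem permUnitary_apply {B : Type} (σ : B ≃ B) (ψ : StateSpace B) (b : B) :
    permUnitary σ ψ b = ψ (σ.symm b) := rfl

/-- The basis states `|q, a, w⟩`: the query register `q` holds an index `i` of the input
(`some i`) or no index (`none`, a null query), the answer register holds an element `a` of an
abelian group `A`, and `w` is the content of the workspace. -/
abbrev Basis (ι A W : Type) : Type := Option ι × A × W

/-- The permutation of basis states made by one query to the input `x`, whose values are written
as elements of `A` through `enc`: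
`|i, a, w⟩ ↦ |i, a + enc (x i), w⟩`, and `|none, a, w⟩ ↦ |none, a, w⟩`. -/
def queryPerm {ι α A W : Type} [AddCommGroup A] (enc : α → A) (x : ι → α) :
    Basis ι A W ≃ Basis ι A W where
  toFun b := (b.1, b.2.1 + b.1.elim 0 (fun i => enc (x i)), b.2.2)
  invFun b := (b.1, b.2.1 - b.1.elim 0 (fun i => enc (x i)), b.2.2)
  left_inv b := by simp
  right_inv b := by simp

/-- A quantum algorithm that makes `numQueries` queries to an input `x : ι → α` and returns an
element of `Ω`. The answer register is an abelian group in which the values `α` are encoded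
injectively (for instance bit strings with bitwise exclusive or), and the workspace is arbitrary.
Only the unitaries `unitary 0, …, unitary numQueries` are used. -/
structure QueryAlgorithm (ι α Ω : Type) where
  /-- The basis of the answer register. -/
  A : Type
  /-- The group structure used to add an answer to the answer register. -/
  [group : AddCommGroup A]
  /-- The encoding of the values of the input. -/
  enc : α → A
  enc_injective : Function.Injective enc
  /-- The basis of the workspace. -/
  W : Type
  /-- The state before the first operation. -/
  init : StateSpace (Basis ι A W)
  norm_init : ‖init‖ = 1
  /-- The number of queries. -/
  numQueries : ℕ
  /-- The unitary operations between the queries; they do not depend on the input. -/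
  unitary : ℕ → (StateSpace (Basis ι A W) ≃ₗᵢ[ℂ] StateSpace (Basis ι A W))
  /-- The output as a function of the measured basis state. -/
  output : Basis ι A W → Ω

namespace QueryAlgorithm

attribute [instance] QueryAlgorithm.group

variable {ι α Ω : Type} (P : QueryAlgorithm ι α Ω)

/-- The query operator `O_x`. -/
def queryOp (x : ι → α) :
    StateSpace (Basis ι P.A P.W) ≃ₗᵢ[ℂ] StateSpace (Basis ι P.A P.W) :=
  permUnitary (queryPerm P.enc x)

/-- The state `U_t O_x U_{t-1} O_x ⋯ O_x U_0 |init⟩` after `t` queries on input `x`. -/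
def state (x : ι → α) : ℕ → StateSpace (Basis ι P.A P.W)
  | 0 => P.unitary 0 P.init
  | t + 1 => P.unitary (t + 1) (P.queryOp x (state x t))

/-- The final state on input `x`. -/
def finalState (x : ι → α) : StateSpace (Basis ι P.A P.W) := P.state x P.numQueries

open Classical in
/-- The probability that, on input `x`, measuring the final state in the computational basis
gives an output in the set `S`. -/
def outputProb (x : ι → α) (S : Set Ω) : ℝ :=
  ∑' b, if P.output b ∈ S then ‖P.finalState x b‖ ^ 2 else 0

/-- `P` solves, with error probability at most `ε`, the search problem in which the inputs are
those of `D` and an output `z` is correct for the input `x` if `Correct x z`. -/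
def Solves (ε : ℝ) (D : Set (ι → α)) (Correct : (ι → α) → Ω → Prop) : Prop :=
  ∀ x ∈ D, 1 - ε ≤ P.outputProb x {z | Correct x z}

end QueryAlgorithm

/-! ### The three problems -/

variable {N : ℕ}

/-- `I` consists of `d` indices mapping to smallest values of `f`. -/
def IsSmallest (d : ℕ) (f : Fin N → ℕ∞) (I : Finset (Fin N)) : Prop :=
  I.card = d ∧ ∀ j ∉ I, ∀ i ∈ I, f i ≤ f j

/-- The number `e` of different types, where `g j` is the type of `j`. -/
def numTypes (g : Fin N → ℕ) : ℕ := (Finset.univ.image g).card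

/-- `I` consists of `min d' e` indices of pairwise different types. -/
def IsDifferentType (d' : ℕ) (g : Fin N → ℕ) (I : Finset (Fin N)) : Prop :=
  I.card = min d' (numTypes g) ∧ ∀ i ∈ I, ∀ i' ∈ I, i ≠ i' → g i ≠ g i'

/-- `I` consists of `min d' e` indices with smallest values of `f` among indices of pairwise
different types under `g`. -/
def IsSmallestDifferentType (d' : ℕ) (f : Fin N → ℕ∞) (g : Fin N → ℕ)
    (I : Finset (Fin N)) : Prop :=
  IsDifferentType d' g I ∧
    ∀ j ∉ I, ∀ i ∈ I, f j < f i → ∃ i' ∈ I, g i' = g j ∧ f i' ≤ f j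

end

end QuantumQuery

namespace QuantumQuery

/-! This is an adversary argument. Cut the indices into `m` blocks of length `L = N / m` and hide
one special index in each block, so that inputs correspond to functions `σ : Fin m → Fin L`; two
inputs are neighbours if they differ in one block. Consider the sum of the overlaps of the states
over all pairs of neighbours. At the start every overlap is `1`, which gives `m * (L - 1)` per
input. A query lowers the sum by at most `2 * √(L - 1)` per input (`overlap_le_overlap_succ`). At
the end a correct output contains all the special indices and at most `D ≤ 1` others, so few
neighbours share it and most pairs are nearly distinguished (`overlap_final_le`). Hence about `m *
√(L - 1)`, that is `√(m * N)`, queries are needed. The three problems differ only in the planted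
values: `m = d` and `D = 0` for smallest values (with or without types), `m = d - 1` and `D = 1` for
different types. -/

open Classical in
/-- The part of a state on the basis states in `S`. -/
noncomputable def restrict {B : Type} (S : Set B) (ψ : StateSpace B) : StateSpace B :=
  ⟨S.indicator ψ, by
    have h := (memℓp_gen_iff (p := 2) (by norm_num)).1 (lp.memℓp ψ)
    refine memℓp_gen (h.of_nonneg_of_le (fun b => by positivity) fun b => ?_)
    by_cases hb : b ∈ S <;> simp [hb]⟩

/-! ### Restrictions of states to sets of basis states -/

section restrict

variable {B : Type} (S S' : Set B) (ψ φ : StateSpace B)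

theorem restrict_apply (b : B) : restrict S ψ b = S.indicator ψ b := rfl

theorem restrict_restrict : restrict S (restrict S' ψ) = restrict (S ∩ S') ψ := by
  ext b
  by_cases h : b ∈ S <;> by_cases h' : b ∈ S' <;> simp [restrict_apply, h, h']

theorem norm_sq_eq_tsum : ‖ψ‖ ^ 2 = ∑' b, ‖ψ b‖ ^ 2 := by
  have := lp.norm_rpow_eq_tsum (p := 2) (by norm_num) ψ
  simpa using this

theorem summable_norm_sq : Summable fun b => ‖ψ b‖ ^ 2 := by
  have h := (memℓp_gen_iff (p := 2) (by norm_num)).1 (lp.memℓp ψ)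
  simpa using h

theorem inner_eq_restrict_add_restrict_compl :
    inner ℂ ψ φ = inner ℂ (restrict S ψ) (restrict S φ) +
      inner ℂ (restrict Sᶜ ψ) (restrict Sᶜ φ) := by
  rw [lp.inner_eq_tsum, lp.inner_eq_tsum, lp.inner_eq_tsum,
    ← (lp.summable_inner _ _).tsum_add (lp.summable_inner _ _)]
  refine tsum_congr fun b => ?_
  by_cases h : b ∈ S <;> simp [restrict_apply, h]

theorem inner_eq_restrict_three (h : Disjoint S S') :
    inner ℂ ψ φ = inner ℂ (restrict S ψ) (restrict S φ) +
      (inner ℂ (restrict S' ψ) (restrict S' φ) +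
        inner ℂ (restrict (S ∪ S')ᶜ ψ) (restrict (S ∪ S')ᶜ φ)) := by
  have h₁ : S' ∩ Sᶜ = S' := Set.inter_eq_left.2 fun b hb hS => Set.disjoint_left.1 h hS hb
  have h₂ : S'ᶜ ∩ Sᶜ = (S ∪ S')ᶜ := by ext; simp [and_comm]
  rw [inner_eq_restrict_add_restrict_compl S,
    inner_eq_restrict_add_restrict_compl S' (restrict Sᶜ ψ)]
  simp only [restrict_restrict, h₁, h₂]

theorem permUnitary_restrict (σ : B ≃ B) (h : ∀ b, σ.symm b ∈ S ↔ b ∈ S) :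
    restrict S (permUnitary σ ψ) = permUnitary σ (restrict S ψ) := by
  ext b
  by_cases hb : b ∈ S
  · simp [restrict_apply, hb, (h b).2 hb]
  · simp [restrict_apply, hb, mt (h b).1 hb]

theorem norm_sq_restrict_add_compl :
    ‖restrict S ψ‖ ^ 2 + ‖restrict Sᶜ ψ‖ ^ 2 = ‖ψ‖ ^ 2 := by
  simp only [norm_sq_eq_tsum]
  rw [← (summable_norm_sq _).tsum_add (summable_norm_sq _)]
  refine tsum_congr fun b => ?_
  by_cases h : b ∈ S <;> simp [restrict_apply, h]

-- Double counting: no basis state lies in more than `D` of the sets. It serves for the masses of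
-- the queries, for the final overlap and for algorithms without queries.
open Classical in
theorem sum_norm_sq_restrict_le {τ : Type} (s : Finset τ) (F : τ → Set B) (D : ℕ)
    (hD : ∀ b, ∀ u ⊆ s, (∀ i ∈ u, b ∈ F i) → u.card ≤ D) :
    ∑ i ∈ s, ‖restrict (F i) ψ‖ ^ 2 ≤ D * ‖ψ‖ ^ 2 := by
  simp only [norm_sq_eq_tsum]
  rw [← Summable.tsum_finsetSum fun i _ => summable_norm_sq _, ← tsum_mul_left]
  refine Summable.tsum_le_tsum (fun b => ?_) (summable_sum fun i _ => summable_norm_sq _)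
    ((summable_norm_sq _).mul_left _)
  have h : ∀ i, ‖restrict (F i) ψ b‖ ^ 2 = if b ∈ F i then ‖ψ b‖ ^ 2 else 0 := fun i => by
    by_cases h : b ∈ F i <;> simp [restrict_apply, h]
  simp only [h]
  rw [← Finset.sum_filter, Finset.sum_const, nsmul_eq_mul]
  gcongr
  exact hD b _ (Finset.filter_subset _ _) fun i hi => (Finset.mem_filter.1 hi).2

theorem norm_sq_restrict_mono (h : S ⊆ S') : ‖restrict S ψ‖ ^ 2 ≤ ‖restrict S' ψ‖ ^ 2 := by
  have := norm_sq_restrict_add_compl S (restrict S' ψ)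
  rw [restrict_restrict, Set.inter_eq_left.2 h] at this
  nlinarith [sq_nonneg ‖restrict Sᶜ (restrict S' ψ)‖]

end restrict

theorem mul_add_mul_le_two_sqrt {ε a b c d : ℝ} (hε₀ : 0 ≤ ε) (hε : ε < 1 / 2)
    (hab : a ^ 2 + b ^ 2 ≤ 1) (hcd : c ^ 2 + d ^ 2 ≤ 1) (hb : b ^ 2 ≤ ε) (hc : c ^ 2 ≤ ε) :
    a * c + b * d ≤ 2 * √(ε * (1 - ε)) := by
  rcases hε₀.eq_or_lt with rfl | hpos
  · have hb : b = 0 := by nlinarith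
    have hc : c = 0 := by nlinarith
    simp [hb, hc]
  have hs := Real.sq_sqrt hε₀
  have ht := Real.sq_sqrt (show (0 : ℝ) ≤ 1 - ε by linarith)
  have hs0 : 0 < √ε := Real.sqrt_pos.2 hpos
  have ht0 : 0 < √(1 - ε) := Real.sqrt_pos.2 (by linarith)
  rw [Real.sqrt_mul hε₀]
  set s := √ε
  set t := √(1 - ε)
  have hst : 0 < 2 * (s * t) := by positivity
  refine le_of_mul_le_mul_left ?_ hst
  -- AM-GM with weights that make it sharp at `a = d = t`, `b = c = s`. The right side is at most
  -- `2ε + (1 - 2ε)(b² + c²) ≤ 4ε(1 - ε)`.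
  have h₁ : 2 * (s * t) * (a * c + b * d) ≤
      s ^ 2 * (a ^ 2 + d ^ 2) + t ^ 2 * (b ^ 2 + c ^ 2) := by
    nlinarith [sq_nonneg (s * a - t * c), sq_nonneg (s * d - t * b)]
  have h₂ : 2 * (s * t) * (2 * (s * t)) = 4 * (s ^ 2 * t ^ 2) := by ring
  rw [h₂]
  refine h₁.trans ?_
  rw [hs, ht]
  nlinarith

/-- Two states for which measurements give outputs in `S` and `S'`, respectively, with probability
at least `1 - ε` can overlap only as far as `S ∩ S'` and `ε` allow. -/
theorem norm_inner_le_of_restrict {B : Type} {ε : ℝ} (hε₀ : 0 ≤ ε) (hε : ε < 1 / 2)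
    {S S' : Set B} {ψ φ : StateSpace B} (hψ : ‖ψ‖ = 1) (hφ : ‖φ‖ = 1)
    (hS : 1 - ε ≤ ‖restrict S ψ‖ ^ 2) (hS' : 1 - ε ≤ ‖restrict S' φ‖ ^ 2) :
    ‖inner ℂ ψ φ‖ ≤ (‖restrict (S ∩ S') ψ‖ ^ 2 + ‖restrict (S ∩ S') φ‖ ^ 2) / 2 +
      2 * √(ε * (1 - ε)) := by
  -- Split the basis into `S ∩ S'`, `S \ S'` and `Sᶜ`: `φ` is small on the second part and `ψ` on
  -- the third.
  have hdisj : Disjoint (S ∩ S') (S \ S') :=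
    Set.disjoint_left.2 fun b hb hb' => hb'.2 hb.2
  have hU : (S ∩ S') ∪ (S \ S') = S := Set.inter_union_sdiff S S'
  have hψS := norm_sq_restrict_add_compl S ψ
  have hφS := norm_sq_restrict_add_compl S φ
  have hφS' := norm_sq_restrict_add_compl S' φ
  have h₁ := norm_sq_restrict_mono (S \ S') S ψ Set.sdiff_subset
  have h₂ := norm_sq_restrict_mono (S \ S') S φ Set.sdiff_subset
  have h₃ := norm_sq_restrict_mono (S \ S') S'ᶜ φ fun b hb => hb.2
  rw [hψ] at hψS
  rw [hφ] at hφS hφS'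
  have key := mul_add_mul_le_two_sqrt (a := ‖restrict (S \ S') ψ‖) (b := ‖restrict Sᶜ ψ‖)
    (c := ‖restrict (S \ S') φ‖) (d := ‖restrict Sᶜ φ‖) hε₀ hε (by linarith) (by linarith)
    (by linarith) (by linarith)
  rw [inner_eq_restrict_three _ _ ψ φ hdisj, hU]
  have n₁ := norm_inner_le_norm (𝕜 := ℂ) (restrict (S ∩ S') ψ) (restrict (S ∩ S') φ)
  have n₂ := norm_inner_le_norm (𝕜 := ℂ) (restrict (S \ S') ψ) (restrict (S \ S') φ)
  have n₃ := norm_inner_le_norm (𝕜 := ℂ) (restrict Sᶜ ψ) (restrict Sᶜ φ)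
  refine (norm_add_le _ _).trans ((add_le_add le_rfl (norm_add_le _ _)).trans ?_)
  nlinarith [sq_nonneg (‖restrict (S ∩ S') ψ‖ - ‖restrict (S ∩ S') φ‖)]

/-! ### The effect of one query on a pair of inputs -/

namespace QueryAlgorithm

variable {ι α Ω : Type} (P : QueryAlgorithm ι α Ω)

theorem norm_state (x : ι → α) (t : ℕ) : ‖P.state x t‖ = 1 := by
  induction t with
  | zero => simp [state, P.norm_init]
  | succ t ih => simp [state, ih]

theorem outputProb_eq (x : ι → α) (S : Set Ω) :
    P.outputProb x S = ‖restrict (P.output ⁻¹' S) (P.finalState x)‖ ^ 2 := by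
  rw [norm_sq_eq_tsum]
  refine tsum_congr fun b => ?_
  by_cases h : P.output b ∈ S <;> simp [restrict_apply, h]

/-- The basis states in which the query register holds `j`. -/
def querySet (j : ι) : Set (Basis ι P.A P.W) := {b | b.1 = some j}

/-- The amount by which a query to `j` takes part in the next query. -/
noncomputable def queryMass (x : ι → α) (t : ℕ) (j : ι) : ℝ :=
  ‖restrict (P.querySet j) (P.state x t)‖

theorem sum_queryMass_sq_le {τ : Type} (s : Finset τ) (f : τ → ι) (hf : Set.InjOn f s)
    (x : ι → α) (t : ℕ) : ∑ i ∈ s, P.queryMass x t (f i) ^ 2 ≤ 1 := by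
  have := sum_norm_sq_restrict_le (P.state x t) s (fun i => P.querySet (f i)) 1
    fun b u hu hb => Finset.card_le_one.2 fun i hi j hj => hf (hu hi) (hu hj)
      (Option.some_injective _ (Eq.trans (Eq.symm (hb i hi)) (hb j hj)))
  simpa [norm_state, queryMass] using this

theorem restrict_queryOp (x : ι → α) (q : Set (Option ι))
    (ψ : StateSpace (Basis ι P.A P.W)) :
    restrict {b | b.1 ∈ q} (P.queryOp x ψ) = P.queryOp x (restrict {b | b.1 ∈ q} ψ) :=
  permUnitary_restrict _ _ _ fun _ => Iff.rfl

theorem queryOp_restrict_congr {x y : ι → α} {q : Set (Option ι)}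
    (h : ∀ j, some j ∈ q → x j = y j) (ψ : StateSpace (Basis ι P.A P.W)) :
    P.queryOp x (restrict {b | b.1 ∈ q} ψ) = P.queryOp y (restrict {b | b.1 ∈ q} ψ) := by
  ext b
  obtain ⟨_ | j, a, w⟩ := b
  · rfl
  · by_cases hj : some j ∈ q
    · simp [queryOp, queryPerm, restrict_apply, h j hj]
    · simp [queryOp, queryPerm, restrict_apply, hj]

/-- One query changes the overlap for two inputs by an amount that is bounded by the masses of the
queries to the positions where the inputs differ. -/
theorem norm_inner_state_le {x y : ι → α} {i j : ι} (hij : i ≠ j)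
    (h : ∀ k, k ≠ i → k ≠ j → x k = y k) (t : ℕ) :
    ‖inner ℂ (P.state x t) (P.state y t)‖ ≤
      ‖inner ℂ (P.state x (t + 1)) (P.state y (t + 1))‖ +
        2 * (P.queryMass x t i * P.queryMass y t i + P.queryMass x t j * P.queryMass y t j) := by
  have hd : Disjoint (P.querySet i) (P.querySet j) := Set.disjoint_left.2 fun b hb hb' =>
    hij (Option.some_injective _ (Eq.trans (Eq.symm hb) hb'))
  have hu : (P.querySet i ∪ P.querySet j)ᶜ = {b | b.1 ∈ ({some i, some j} : Set (Option ι))ᶜ} := by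
    ext b; simp [querySet]
  have hq : ∀ k, P.querySet k = {b | b.1 ∈ ({some k} : Set (Option ι))} := fun k => by
    ext b; simp [querySet]
  have e₁ := inner_eq_restrict_three _ _ (P.state x t) (P.state y t) hd
  have e₂ := inner_eq_restrict_three _ _ (P.queryOp x (P.state x t))
    (P.queryOp y (P.state y t)) hd
  have e₃ : inner ℂ (P.state x (t + 1)) (P.state y (t + 1)) =
      inner ℂ (P.queryOp x (P.state x t)) (P.queryOp y (P.state y t)) := by
    simp only [state, LinearIsometryEquiv.inner_map_map]
  -- Away from `i` and `j` both query operators are the same isometry, so this part of the overlap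
  -- cancels.
  have e₄ : inner ℂ (restrict (P.querySet i ∪ P.querySet j)ᶜ (P.queryOp x (P.state x t)))
      (restrict (P.querySet i ∪ P.querySet j)ᶜ (P.queryOp y (P.state y t))) =
      inner ℂ (restrict (P.querySet i ∪ P.querySet j)ᶜ (P.state x t))
      (restrict (P.querySet i ∪ P.querySet j)ᶜ (P.state y t)) := by
    rw [hu, restrict_queryOp, restrict_queryOp,
      P.queryOp_restrict_congr (x := y) (y := x), LinearIsometryEquiv.inner_map_map]
    intro k hk
    simp only [Set.mem_compl_iff, Set.mem_insert_iff, Set.mem_singleton_iff, Option.some.injEq,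
      not_or] at hk
    exact (h k hk.1 hk.2).symm
  have n₁ : ∀ k, ‖inner ℂ (restrict (P.querySet k) (P.queryOp x (P.state x t)))
      (restrict (P.querySet k) (P.queryOp y (P.state y t)))‖ ≤
      P.queryMass x t k * P.queryMass y t k := fun k => by
    refine (norm_inner_le_norm _ _).trans_eq ?_
    simp only [queryMass, hq, restrict_queryOp, LinearIsometryEquiv.norm_map]
  have n₂ : ∀ k, ‖inner ℂ (restrict (P.querySet k) (P.state x t))
      (restrict (P.querySet k) (P.state y t))‖ ≤
      P.queryMass x t k * P.queryMass y t k := fun k => norm_inner_le_norm _ _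
  have hdiff : ∀ a b c a' b' : ℂ, ‖a + (b + c)‖ ≤
      ‖a' + (b' + c)‖ + ((‖a‖ + ‖a'‖) + (‖b‖ + ‖b'‖)) := fun a b c a' b' => by
    have : a + (b + c) = a' + (b' + c) + ((a - a') + (b - b')) := by ring
    rw [this]
    refine (norm_add_le _ _).trans (add_le_add le_rfl ((norm_add_le _ _).trans ?_))
    exact add_le_add (norm_sub_le _ _) (norm_sub_le _ _)
  rw [e₃, e₁, e₂, e₄]
  refine (hdiff _ _ _ _ _).trans (add_le_add le_rfl ?_)
  linarith [n₁ i, n₁ j, n₂ i, n₂ j]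

end QueryAlgorithm

/-! ### Pairs of neighbouring functions -/

section moves

variable (K V : Type) [Fintype K] [Fintype V] [DecidableEq K] [DecidableEq V]

/-- The ways `(σ, k, l)` to change the function `σ : K → V` at one place `k` to a new value `l`. -/
def moves : Finset ((K → V) × K × V) := Finset.univ.filter fun r => r.2.2 ≠ r.1 r.2.1

variable {K V}

/-- The function that a change leads to. -/
def moveTarget (r : (K → V) × K × V) : K → V := Function.update r.1 r.2.1 r.2.2

/-- The change back. -/
def moveBack (r : (K → V) × K × V) : (K → V) × K × V := (moveTarget r, r.2.1, r.1 r.2.1)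

omit [Fintype K] [Fintype V] [DecidableEq V] in
theorem moveBack_moveBack (r : (K → V) × K × V) : moveBack (moveBack r) = r := by
  simp [moveBack, moveTarget]

theorem moveBack_mem {r : (K → V) × K × V} (hr : r ∈ moves K V) : moveBack r ∈ moves K V := by
  simpa [moves, moveBack, moveTarget] using (Finset.mem_filter.1 hr).2.symm

theorem sum_moveBack (F : (K → V) × K × V → ℝ) :
    ∑ r ∈ moves K V, F (moveBack r) = ∑ r ∈ moves K V, F r :=
  Finset.sum_nbij' moveBack moveBack (fun _ => moveBack_mem) (fun _ => moveBack_mem)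
    (fun r _ => moveBack_moveBack r) (fun r _ => moveBack_moveBack r) fun _ _ => rfl

theorem sum_moves (F : (K → V) × K × V → ℝ) :
    ∑ r ∈ moves K V, F r =
      ∑ σ, ∑ p ∈ Finset.univ.filter fun p : K × V => p.2 ≠ σ p.1, F (σ, p) := by
  simp only [moves, Finset.sum_filter]
  rw [Fintype.sum_prod_type]

theorem sum_moves_eq_sum_sum (F : (K → V) × K × V → ℝ) :
    ∑ r ∈ moves K V, F r = ∑ σ, ∑ k, ∑ l ∈ Finset.univ.erase (σ k), F (σ, k, l) := by
  rw [sum_moves]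
  refine Finset.sum_congr rfl fun σ _ => ?_
  rw [Finset.sum_filter, Fintype.sum_prod_type]
  refine Finset.sum_congr rfl fun k _ => ?_
  rw [← Finset.sum_filter]
  refine Finset.sum_congr ?_ fun _ _ => rfl
  ext l; simp

theorem card_moves [Nonempty V] : ((moves K V).card : ℝ) =
    Fintype.card (K → V) * (Fintype.card K * (Fintype.card V - 1)) := by
  have := sum_moves_eq_sum_sum (K := K) (V := V) fun _ => 1
  simp only [Finset.sum_const, nsmul_eq_mul, mul_one, Finset.card_erase_of_mem (Finset.mem_univ _),
    Finset.card_univ, Nat.cast_sub (Nat.one_le_iff_ne_zero.2 Fintype.card_ne_zero), Nat.cast_one]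
    at this
  exact this

end moves

/-! ### The adversary bound -/

namespace QueryAlgorithm

variable {ι α Ω K V : Type} [Fintype K] [Fintype V] [DecidableEq K] [DecidableEq V]
  (P : QueryAlgorithm ι α Ω)

/-- The total overlap after `t` queries of the states for neighbouring inputs of the family `x`. -/
noncomputable def overlap (x : (K → V) → ι → α) (t : ℕ) : ℝ :=
  ∑ r ∈ moves K V, ‖inner ℂ (P.state (x r.1) t) (P.state (x (moveTarget r)) t)‖

theorem overlap_zero (x : (K → V) → ι → α) : P.overlap x 0 = (moves K V).card := by
  have h : ‖P.unitary 0 P.init‖ = 1 := by simp [P.norm_init]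
  simp [overlap, state, P.norm_init]

variable [Nonempty V] {e : K → V → ι} (he : Function.Injective2 e) {x : (K → V) → ι → α}

-- The square root comes from a weighted AM-GM, `2 * s * a * b ≤ a² + s² * b²` with `s² = |V| - 1`.
-- Each planted position occurs as the old position of `s²` moves, whereas reversal turns the masses
-- `b` into those of the unplanted positions, once each. Both sums together are thus `s²` times a
-- total mass of at most `1` per input.
include he in
theorem sum_mass_mul_mass_le (t : ℕ) :
    2 * ∑ r ∈ moves K V, P.queryMass (x r.1) t (e r.2.1 (r.1 r.2.1)) *
      P.queryMass (x (moveTarget r)) t (e r.2.1 (r.1 r.2.1)) ≤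
    √(Fintype.card V - 1) * Fintype.card (K → V) := by
  set s : ℝ := √(Fintype.card V - 1)
  have hV : (1 : ℝ) ≤ Fintype.card V := by exact_mod_cast Fintype.card_pos (α := V)
  have hs2 : s ^ 2 = Fintype.card V - 1 := Real.sq_sqrt (by linarith)
  have hs0 : 0 ≤ s := Real.sqrt_nonneg _
  clear_value s
  -- If `s = 0`, then `V` has one element and there are no moves.
  rcases hs0.eq_or_lt with rfl | hpos
  · have hc : ((moves K V).card : ℝ) = 0 := by rw [card_moves, ← hs2]; simp
    have hc' : moves K V = ∅ := Finset.card_eq_zero.1 (by exact_mod_cast hc)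
    simp [hc']
  have hA : ∑ r ∈ moves K V, P.queryMass (x r.1) t (e r.2.1 (r.1 r.2.1)) ^ 2 =
      s ^ 2 * ∑ σ, ∑ k, P.queryMass (x σ) t (e k (σ k)) ^ 2 := by
    rw [sum_moves_eq_sum_sum, Finset.mul_sum]
    refine Finset.sum_congr rfl fun σ _ => ?_
    rw [Finset.mul_sum]
    refine Finset.sum_congr rfl fun k _ => ?_
    dsimp only
    rw [Finset.sum_const, nsmul_eq_mul, Finset.card_erase_of_mem (Finset.mem_univ _),
      Finset.card_univ, Nat.cast_sub (Nat.one_le_iff_ne_zero.2 Fintype.card_ne_zero), hs2,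
      Nat.cast_one]
  have hB : ∑ r ∈ moves K V, P.queryMass (x (moveTarget r)) t (e r.2.1 (r.1 r.2.1)) ^ 2 =
      ∑ σ, ∑ k, ∑ l ∈ Finset.univ.erase (σ k), P.queryMass (x σ) t (e k l) ^ 2 := by
    rw [← sum_moves_eq_sum_sum fun r => P.queryMass (x r.1) t (e r.2.1 r.2.2) ^ 2]
    exact sum_moveBack fun r => P.queryMass (x r.1) t (e r.2.1 r.2.2) ^ 2
  have hAB : ∑ σ, ∑ k, P.queryMass (x σ) t (e k (σ k)) ^ 2 +
      ∑ σ, ∑ k, ∑ l ∈ Finset.univ.erase (σ k), P.queryMass (x σ) t (e k l) ^ 2 ≤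
      Fintype.card (K → V) := by
    rw [← Finset.sum_add_distrib]
    have : ∀ σ : K → V, ∑ k, P.queryMass (x σ) t (e k (σ k)) ^ 2 +
        ∑ k, ∑ l ∈ Finset.univ.erase (σ k), P.queryMass (x σ) t (e k l) ^ 2 ≤ 1 := fun σ => by
      rw [← Finset.sum_add_distrib]
      have h : ∀ k, P.queryMass (x σ) t (e k (σ k)) ^ 2 +
          ∑ l ∈ Finset.univ.erase (σ k), P.queryMass (x σ) t (e k l) ^ 2 =
          ∑ l, P.queryMass (x σ) t (e k l) ^ 2 := fun k =>
        Finset.add_sum_erase _ (fun l => P.queryMass (x σ) t (e k l) ^ 2) (Finset.mem_univ _)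
      simp only [h]
      rw [← Fintype.sum_prod_type fun p : K × V => P.queryMass (x σ) t (e p.1 p.2) ^ 2]
      exact P.sum_queryMass_sq_le _ (fun p : K × V => e p.1 p.2)
        (fun p _ q _ h => Prod.ext (he h).1 (he h).2) _ _
    refine (Finset.sum_le_sum fun σ _ => this σ).trans ?_
    simp
  have hab : s * (2 * ∑ r ∈ moves K V, P.queryMass (x r.1) t (e r.2.1 (r.1 r.2.1)) *
      P.queryMass (x (moveTarget r)) t (e r.2.1 (r.1 r.2.1))) ≤
      ∑ r ∈ moves K V, P.queryMass (x r.1) t (e r.2.1 (r.1 r.2.1)) ^ 2 +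
      s ^ 2 * ∑ r ∈ moves K V,
        P.queryMass (x (moveTarget r)) t (e r.2.1 (r.1 r.2.1)) ^ 2 := by
    simp only [Finset.mul_sum, ← Finset.sum_add_distrib]
    refine Finset.sum_le_sum fun r _ => ?_
    nlinarith [sq_nonneg (P.queryMass (x r.1) t (e r.2.1 (r.1 r.2.1)) -
      s * P.queryMass (x (moveTarget r)) t (e r.2.1 (r.1 r.2.1)))]
  rw [hA, hB, ← mul_add] at hab
  refine le_of_mul_le_mul_left (hab.trans ?_) hpos
  rw [← mul_assoc, ← sq]
  gcongr

-- Reversing the moves exchanges old and new positions, so both contribute the same sum.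
include he in
theorem overlap_le_overlap_succ
    (hx : ∀ σ k l j, j ≠ e k (σ k) → j ≠ e k l → x σ j = x (Function.update σ k l) j) (t : ℕ) :
    P.overlap x t ≤ P.overlap x (t + 1) +
      2 * (√(Fintype.card V - 1) * Fintype.card (K → V)) := by
  have h₁ := P.sum_mass_mul_mass_le he (x := x) t
  have h₂ : ∑ r ∈ moves K V, P.queryMass (x r.1) t (e r.2.1 r.2.2) *
      P.queryMass (x (moveTarget r)) t (e r.2.1 r.2.2) =
      ∑ r ∈ moves K V, P.queryMass (x r.1) t (e r.2.1 (r.1 r.2.1)) *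
      P.queryMass (x (moveTarget r)) t (e r.2.1 (r.1 r.2.1)) := by
    rw [← sum_moveBack]
    refine Finset.sum_congr rfl fun r _ => ?_
    have : moveTarget (moveBack r) = r.1 := congrArg Prod.fst (moveBack_moveBack r)
    rw [this, mul_comm]
    rfl
  have h₃ : P.overlap x t ≤ P.overlap x (t + 1) +
      2 * (∑ r ∈ moves K V, P.queryMass (x r.1) t (e r.2.1 (r.1 r.2.1)) *
        P.queryMass (x (moveTarget r)) t (e r.2.1 (r.1 r.2.1)) +
      ∑ r ∈ moves K V, P.queryMass (x r.1) t (e r.2.1 r.2.2) *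
        P.queryMass (x (moveTarget r)) t (e r.2.1 r.2.2)) := by
    rw [← Finset.sum_add_distrib, Finset.mul_sum, overlap, overlap, ← Finset.sum_add_distrib]
    refine Finset.sum_le_sum fun r hr => ?_
    refine P.norm_inner_state_le (fun h => ?_) (fun j hj hj' => hx _ _ _ j hj hj') t
    exact (Finset.mem_filter.1 hr).2 (he h).2.symm
  linarith

-- Reversal merges the two terms of `norm_inner_le_of_restrict` into one sum; in it, for fixed `σ`,
-- a basis state counts at most `D` times, once for each neighbour that shares its output.
omit [Nonempty V] in
theorem overlap_final_le {ε : ℝ} (hε₀ : 0 ≤ ε) (hε : ε < 1 / 2) (G : (K → V) → Set Ω)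
    (hG : ∀ σ, 1 - ε ≤ P.outputProb (x σ) (G σ)) (D : ℕ)
    (hD : ∀ σ, ∀ z ∈ G σ, ∀ u : Finset (K × V),
      (∀ p ∈ u, p.2 ≠ σ p.1 ∧ z ∈ G (Function.update σ p.1 p.2)) → u.card ≤ D) :
    P.overlap x P.numQueries ≤
      D * Fintype.card (K → V) + 2 * √(ε * (1 - ε)) * (moves K V).card := by
  let C : (K → V) × K × V → Set (Basis ι P.A P.W) := fun r =>
    P.output ⁻¹' G r.1 ∩ P.output ⁻¹' G (moveTarget r)
  let F : (K → V) × K × V → ℝ := fun r => ‖restrict (C r) (P.finalState (x r.1))‖ ^ 2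
  have h₁ : P.overlap x P.numQueries ≤
      ∑ r ∈ moves K V, ((F r + F (moveBack r)) / 2 + 2 * √(ε * (1 - ε))) := by
    refine Finset.sum_le_sum fun r _ => ?_
    have hC : C (moveBack r) = C r := by
      have : moveTarget (moveBack r) = r.1 := congrArg Prod.fst (moveBack_moveBack r)
      simp only [C, this]
      exact Set.inter_comm _ _
    simp only [F, hC]
    refine norm_inner_le_of_restrict hε₀ hε (P.norm_state _ _) (P.norm_state _ _) ?_ ?_
    · exact (hG r.1).trans_eq (P.outputProb_eq _ _)
    · exact (hG (moveTarget r)).trans_eq (P.outputProb_eq _ _)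
  have h₂ : ∑ r ∈ moves K V, F r ≤ D * Fintype.card (K → V) := by
    rw [sum_moves]
    have : ∀ σ : K → V, ∑ p ∈ Finset.univ.filter (fun p : K × V => p.2 ≠ σ p.1), F (σ, p) ≤ D :=
      fun σ => by
        have := sum_norm_sq_restrict_le (P.finalState (x σ))
          (Finset.univ.filter fun p : K × V => p.2 ≠ σ p.1) (fun p => C (σ, p)) D
          fun b u hu hb => by
            -- That the output lies in `G σ` is read off from a member of `u`.
            rcases u.eq_empty_or_nonempty with rfl | ⟨p, hp⟩
            · simp
            · exact hD σ _ (hb p hp).1 u fun q hq =>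
                ⟨(Finset.mem_filter.1 (hu hq)).2, (hb q hq).2⟩
        refine this.trans_eq ?_
        rw [finalState, norm_state]; simp
    refine (Finset.sum_le_sum fun σ _ => this σ).trans_eq ?_
    simp [mul_comm]
  refine h₁.trans ?_
  rw [Finset.sum_add_distrib, ← Finset.sum_div, Finset.sum_add_distrib, sum_moveBack,
    Finset.sum_const, nsmul_eq_mul]
  linarith

include he in
/-- The adversary bound for a family of inputs indexed by the functions `K → V`, in which a change
of the function at one place changes two values of the input. -/
theorem adversary_bound {ε : ℝ} (hε₀ : 0 ≤ ε) (hε : ε < 1 / 2)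
    (hx : ∀ σ k l j, j ≠ e k (σ k) → j ≠ e k l → x σ j = x (Function.update σ k l) j)
    (G : (K → V) → Set Ω) (hG : ∀ σ, 1 - ε ≤ P.outputProb (x σ) (G σ)) (D : ℕ)
    (hD : ∀ σ, ∀ z ∈ G σ, ∀ u : Finset (K × V),
      (∀ p ∈ u, p.2 ≠ σ p.1 ∧ z ∈ G (Function.update σ p.1 p.2)) → u.card ≤ D) :
    (1 - 2 * √(ε * (1 - ε))) * (Fintype.card K * (Fintype.card V - 1)) - D ≤
      2 * P.numQueries * √(Fintype.card V - 1) := by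
  have h : ∀ t : ℕ, P.overlap x 0 ≤ P.overlap x t +
      t * (2 * (√(Fintype.card V - 1) * Fintype.card (K → V))) := fun t => by
    induction t with
    | zero => simp
    | succ t ih =>
      have := P.overlap_le_overlap_succ he hx t
      push_cast
      linarith
  have h₁ := h P.numQueries
  have h₂ := P.overlap_final_le hε₀ hε G hG D hD
  rw [overlap_zero, card_moves] at h₁
  rw [card_moves] at h₂
  have hpos : (0 : ℝ) < Fintype.card (K → V) := by exact_mod_cast Fintype.card_pos
  refine le_of_mul_le_mul_left ?_ hpos
  linarith

/-- Without queries, an output that is correct for at most half of the inputs is not found with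
probability more than `1 / 2`. -/
theorem numQueries_pos {τ : Type} (s : Finset τ) {ε : ℝ} (hε : ε < 1 / 2) (x : τ → ι → α)
    (G : τ → Set Ω) (hG : ∀ σ ∈ s, 1 - ε ≤ P.outputProb (x σ) (G σ)) (D : ℕ)
    (hD : ∀ z, ∀ u ⊆ s, (∀ σ ∈ u, z ∈ G σ) → u.card ≤ D) (hs : s.Nonempty) (hsD : 2 * D ≤ s.card) :
    1 ≤ P.numQueries := by
  by_contra! h
  have h0 : ∀ x, P.finalState x = P.unitary 0 P.init := fun x => by
    rw [finalState, Nat.lt_one_iff.1 h]; rfl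
  have h₁ := sum_norm_sq_restrict_le (P.unitary 0 P.init) s (fun σ => P.output ⁻¹' G σ) D
    fun b => hD (P.output b)
  have h₂ : ∑ σ ∈ s, (1 - ε) ≤ ∑ σ ∈ s, ‖restrict (P.output ⁻¹' G σ) (P.unitary 0 P.init)‖ ^ 2 :=
    Finset.sum_le_sum fun σ hσ => by
      have := hG σ hσ
      rwa [outputProb_eq, h0] at this
  rw [Finset.sum_const, nsmul_eq_mul] at h₂
  have hn : ‖P.unitary 0 P.init‖ = 1 := by simp [P.norm_init]
  rw [hn] at h₁
  have hc : (0 : ℝ) < s.card := by exact_mod_cast hs.card_pos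
  have hsD' : (2 : ℝ) * D ≤ s.card := by exact_mod_cast hsD
  nlinarith

end QueryAlgorithm

/-! ### Inputs with planted values -/

section planted

variable {ι α K V : Type}

/-- The input with the value `u k` at the position `e k (σ k)` of the block `k`, and with the
value `v` elsewhere. -/
noncomputable def planted (e : K → V → ι) (u : K → α) (v : α) (σ : K → V) : ι → α :=
  Function.extend (fun k => e k (σ k)) u fun _ => v

variable {e : K → V → ι} (he : Function.Injective2 e) (u : K → α) (v : α)

include he

theorem injective_position (σ : K → V) : Function.Injective fun k => e k (σ k) :=
  fun _ _ h => (he h).1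

theorem planted_position (σ : K → V) (k : K) : planted e u v σ (e k (σ k)) = u k :=
  (injective_position he σ).extend_apply _ _ k

omit he in
theorem planted_of_ne (σ : K → V) {j : ι} (h : ∀ k, e k (σ k) ≠ j) : planted e u v σ j = v :=
  Function.extend_apply' _ _ _ fun ⟨k, hk⟩ => h k hk

theorem planted_update [DecidableEq K] (σ : K → V) (k : K) (l : V) (j : ι)
    (h : j ≠ e k (σ k)) (h' : j ≠ e k l) :
    planted e u v σ j = planted e u v (Function.update σ k l) j := by
  by_cases hj : ∃ k', e k' (σ k') = j
  · obtain ⟨k', rfl⟩ := hj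
    have hk : k' ≠ k := by rintro rfl; exact h rfl
    have := planted_position he u v (Function.update σ k l) k'
    rw [Function.update_of_ne hk] at this
    rw [planted_position he, this]
  · push Not at hj
    rw [planted_of_ne u v σ hj, planted_of_ne u v]
    intro k' hk'
    by_cases hk : k' = k
    · subst hk; rw [Function.update_self] at hk'; exact h' hk'.symm
    · rw [Function.update_of_ne hk] at hk'; exact hj k' hk'

variable [Fintype K] [DecidableEq ι]

/-- The positions of the planted values. -/
def positions (e : K → V → ι) (σ : K → V) : Finset ι := Finset.univ.image fun k => e k (σ k)

theorem card_positions (σ : K → V) : (positions e σ).card = Fintype.card K :=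
  Finset.card_image_of_injective _ (injective_position he σ)

omit he in
theorem mem_positions {σ : K → V} {j : ι} : j ∈ positions e σ ↔ ∃ k, e k (σ k) = j := by
  simp [positions]

/-- If the positions of two functions are among `Fintype.card K + 1` indices, then these positions
exhaust the indices, and those of every third function are not among them. -/
theorem card_le_two_of_positions_subset [DecidableEq K] {z : Finset ι}
    (hz : z.card ≤ Fintype.card K + 1)
    (s : Finset (K → V)) (hs : ∀ σ ∈ s, positions e σ ⊆ z) : s.card ≤ 2 := by
  by_contra! h
  obtain ⟨a, ha, b, hb, c, hc, hab, hac, hbc⟩ := Finset.two_lt_card.1 h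
  obtain ⟨k₀, hk₀⟩ := Function.ne_iff.1 hab
  have hn : e k₀ (b k₀) ∉ positions e a := fun h => by
    obtain ⟨k, hk⟩ := mem_positions.1 h
    obtain ⟨rfl, hl⟩ := he hk
    exact hk₀ hl
  have hz' : insert (e k₀ (b k₀)) (positions e a) = z :=
    Finset.eq_of_subset_of_card_le
      (Finset.insert_subset (hs b hb (mem_positions.2 ⟨k₀, rfl⟩)) (hs a ha))
      (by rw [Finset.card_insert_of_notMem hn, card_positions he]; exact hz)
  -- Every member of `s` equals `a` except perhaps at `k₀`, where the only other choice is `b k₀`;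
  -- so `c` is `a` or `b`.
  have hτ : ∀ τ ∈ s, ∀ k, (k = k₀ ∧ τ k = b k₀) ∨ τ k = a k := fun τ hτ k => by
    have := hs τ hτ (mem_positions.2 ⟨k, rfl⟩)
    rw [← hz', Finset.mem_insert, mem_positions] at this
    rcases this with h | ⟨k', h⟩
    · exact Or.inl (he h)
    · obtain ⟨rfl, h⟩ := he h
      exact Or.inr h.symm
  rcases hτ c hc k₀ with ⟨-, h⟩ | h
  · refine hbc (funext fun k => ?_)
    by_cases hk : k = k₀
    · rw [hk, h]
    · rw [((hτ b hb k).resolve_left fun h => hk h.1), ((hτ c hc k).resolve_left fun h => hk h.1)]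
  · refine hac (funext fun k => ?_)
    by_cases hk : k = k₀
    · rw [hk, h]
    · exact ((hτ c hc k).resolve_left fun h => hk h.1).symm

/-- The number of queries needed to find few indices that include all planted positions. -/
theorem search_bound [Fintype V] [DecidableEq K] [DecidableEq V] [Nonempty V]
    (P : QueryAlgorithm ι α (Finset ι)) {ε : ℝ} (hε₀ : 0 ≤ ε) (hε : ε < 1 / 2)
    (G : (K → V) → Set (Finset ι))
    (hG : ∀ σ, 1 - ε ≤ P.outputProb (planted e u v σ) (G σ)) (D : ℕ)
    (hD : ∀ σ, ∀ z ∈ G σ, positions e σ ⊆ z ∧ z.card ≤ Fintype.card K + D) :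
    (1 - 2 * √(ε * (1 - ε))) * (Fintype.card K * (Fintype.card V - 1)) - D ≤
      2 * P.numQueries * √(Fintype.card V - 1) := by
  refine P.adversary_bound he hε₀ hε (planted_update he u v) G hG D fun σ z hz s hs => ?_
  have hinj : Function.Injective fun p : K × V => e p.1 p.2 :=
    fun p q h => Prod.ext (he h).1 (he h).2
  -- Each neighbour for which `z` is correct uses up a different one of the at most `D` superfluous
  -- elements of `z`.
  have hsub : s.image (fun p : K × V => e p.1 p.2) ⊆ z \ positions e σ := fun j hj => by
    obtain ⟨p, hp, rfl⟩ := Finset.mem_image.1 hj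
    refine Finset.mem_sdiff.2 ⟨(hD _ z (hs p hp).2).1 (mem_positions.2 ⟨p.1, by simp⟩), fun h => ?_⟩
    obtain ⟨k, hk⟩ := mem_positions.1 h
    obtain ⟨rfl, hk⟩ := he hk
    exact (hs p hp).1 hk.symm
  have := Finset.card_le_card hsub
  rw [Finset.card_image_of_injective _ hinj, Finset.card_sdiff_of_subset (hD σ z hz).1,
    card_positions he] at this
  have := (hD σ z hz).2
  omega

end planted

/-! ### Blocks of indices and the constant -/

/-- A division of some of the `N` indices into `m` blocks of equal length. -/
def blockPosition {N m : ℕ} (k : Fin m) (l : Fin (N / m)) : Fin N :=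
  Fin.castLE (Nat.mul_div_le N m) (finProdFinEquiv (k, l))

theorem injective2_blockPosition {N m : ℕ} :
    Function.Injective2 (blockPosition : Fin m → Fin (N / m) → Fin N) := fun k k' l l' h => by
  have := finProdFinEquiv.injective (Fin.castLE_injective _ h)
  exact ⟨congrArg Prod.fst this, congrArg Prod.snd this⟩

/-- With `s = √(N / m - 1)` the hypothesis reads `η * m * s² - D ≤ 2 * T * s`. If `D` is at most
half of the main term, then `T ≥ η * m * s / 4`; otherwise `η * m * s² < 2`, and `T ≥ 1` suffices.
The form `d ≤ 2 * m` also admits `m = d - 1` for `d ≥ 2`. -/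
theorem sqrt_le_of_search_bound {N d m D T : ℕ} {η : ℝ} (hη₀ : 0 < η) (hm : 0 < m)
    (hmN : 2 * m ≤ N) (hdm : d ≤ 2 * m) (hD : D ≤ 1) (hDT : D = 0 ∨ 1 ≤ T)
    (h : η * (m * (((N / m : ℕ) : ℝ) - 1)) - D ≤ 2 * T * √(((N / m : ℕ) : ℝ) - 1)) :
    η / 12 * √((d : ℝ) * N) ≤ T := by
  have hL : 2 ≤ N / m := (Nat.le_div_iff_mul_le hm).2 hmN
  have hNL : N < m * (N / m + 1) := Nat.lt_mul_div_succ N hm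
  set L := N / m
  have hL' : (2 : ℝ) ≤ L := by exact_mod_cast hL
  have hNL' : (N : ℝ) < m * (L + 1) := by exact_mod_cast hNL
  have hm' : (0 : ℝ) < m := by exact_mod_cast hm
  have hs2 : √((L : ℝ) - 1) ^ 2 = L - 1 := Real.sq_sqrt (by linarith)
  have hs1 : 1 ≤ √((L : ℝ) - 1) := Real.one_le_sqrt.2 (by linarith)
  set s := √((L : ℝ) - 1)
  -- `L + 1 ≤ 3 * (L - 1)` because `L ≥ 2`.
  have hN : (N : ℝ) ≤ 3 * (m * s ^ 2) := by rw [hs2]; nlinarith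
  rw [← hs2] at h
  have hd : (d : ℝ) ≤ 2 * m := by exact_mod_cast hdm
  have hsqrt : √((d : ℝ) * N) ≤ 3 * (m * s) := by
    refine Real.sqrt_le_iff.2 ⟨by positivity, ?_⟩
    have : (d : ℝ) * N ≤ (2 * m) * (3 * (m * s ^ 2)) :=
      mul_le_mul hd hN (by positivity) (by positivity)
    nlinarith [sq_nonneg (m * s)]
  have hT : (0 : ℝ) ≤ T := by positivity
  have h4 : η / 12 * √((d : ℝ) * N) ≤ η * (m * s) / 4 := by
    have := mul_le_mul_of_nonneg_left hsqrt (by positivity : 0 ≤ η / 12)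
    linarith
  refine h4.trans ?_
  rcases le_or_gt (2 * (D : ℝ)) (η * (m * s ^ 2)) with hA | hB
  · refine le_of_mul_le_mul_right ?_ (by linarith : 0 < s)
    nlinarith
  · rcases hDT with rfl | hT1
    · have : 0 < η * (m * s ^ 2) := by positivity
      norm_num at hB
      linarith
    · have hD' : (D : ℝ) ≤ 1 := by exact_mod_cast hD
      have hT1' : (1 : ℝ) ≤ T := by exact_mod_cast hT1
      have : m * s ≤ m * s ^ 2 := by nlinarith
      nlinarith [mul_le_mul_of_nonneg_left this hη₀.le]

variable {N : ℕ}

theorem exists_mem_sdiff_of_not_subset {S I : Finset (Fin N)} (hc : I.card = S.card)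
    (h : ¬ S ⊆ I) : ∃ j ∈ S, j ∉ I ∧ ∃ i ∈ I, i ∉ S := by
  obtain ⟨j, hj, hjI⟩ := Finset.not_subset.1 h
  refine ⟨j, hj, hjI, Finset.not_subset.1 fun hIS => ?_⟩
  exact h (Finset.eq_of_subset_of_card_le hIS hc.ge).ge

theorem positions_subset_of_isSmallest {K V : Type} [Fintype K] {e : K → V → Fin N}
    (he : Function.Injective2 e) {σ : K → V} {I : Finset (Fin N)}
    (h : IsSmallest (Fintype.card K) (planted e (fun _ => 0) 1 σ) I) : positions e σ ⊆ I := by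
  by_contra hI
  obtain ⟨j, hj, hjI, i, hi, hiS⟩ := exists_mem_sdiff_of_not_subset
    (h.1.trans (card_positions he σ).symm) hI
  obtain ⟨k, rfl⟩ := mem_positions.1 hj
  have := h.2 _ hjI i hi
  rw [planted_position he, planted_of_ne _ _ _ fun k hk => hiS (mem_positions.2 ⟨k, hk⟩)] at this
  simp at this

/-! ### Planted types -/

section types

variable {m : ℕ} {V : Type} {e : Fin m → V → Fin N} (he : Function.Injective2 e) (σ : Fin m → V)

include he

theorem exists_notMem_positions (hm : m < N) : ∃ j, ∀ k, e k (σ k) ≠ j := by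
  obtain ⟨j, hj⟩ := Finset.exists_mem_notMem_of_card_lt_card
    (s := positions e σ) (t := Finset.univ) (by simpa [card_positions he] using hm)
  exact ⟨j, fun k hk => hj.2 (mem_positions.2 ⟨k, hk⟩)⟩

theorem numTypes_planted_succ (hm : m < N) :
    numTypes (planted e (fun k => (k : ℕ) + 1) 0 σ) = m + 1 := by
  have : Finset.univ.image (planted e (fun k => (k : ℕ) + 1) 0 σ) = Finset.range (m + 1) := by
    ext t
    simp only [Finset.mem_image, Finset.mem_univ, true_and, Finset.mem_range]
    constructor
    · rintro ⟨j, rfl⟩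
      by_cases hj : ∃ k, e k (σ k) = j
      · obtain ⟨k, rfl⟩ := hj
        rw [planted_position he]
        omega
      · rw [planted_of_ne _ _ _ fun k hk => hj ⟨k, hk⟩]
        omega
    · intro ht
      rcases t with _ | t
      · obtain ⟨j, hj⟩ := exists_notMem_positions he σ hm
        exact ⟨j, planted_of_ne _ _ _ hj⟩
      · exact ⟨_, planted_position he (fun k : Fin m => (k : ℕ) + 1) 0 σ ⟨t, by omega⟩⟩
  rw [numTypes, this, Finset.card_range]

/-- All `m + 1` types must be represented, and each nonzero type occurs only at its planted
position. The one further element represents the background type `0`. -/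
theorem positions_subset_of_isDifferentType (hm : m < N) {d' : ℕ} (hd' : m + 1 ≤ d')
    {I : Finset (Fin N)}
    (h : IsDifferentType d' (planted e (fun k => (k : ℕ) + 1) 0 σ) I) :
    positions e σ ⊆ I ∧ I.card ≤ m + 1 := by
  have hn := numTypes_planted_succ he σ hm
  have hc : I.card = m + 1 := by rw [h.1, hn, min_eq_right hd']
  refine ⟨fun j hj => ?_, hc.le⟩
  have hinj : Set.InjOn (planted e (fun k => (k : ℕ) + 1) 0 σ) I := fun i hi i' hi' hg => by
    by_contra hne
    exact h.2 i hi i' hi' hne hg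
  have himg := Finset.eq_of_subset_of_card_le
    (Finset.image_subset_image (f := planted e (fun k => (k : ℕ) + 1) 0 σ) (Finset.subset_univ I))
    (by rw [Finset.card_image_of_injOn hinj, hc]; exact hn.le)
  obtain ⟨k, rfl⟩ := mem_positions.1 hj
  obtain ⟨i, hi, hik⟩ := Finset.mem_image.1
    (himg.ge (Finset.mem_image_of_mem _ (Finset.mem_univ (e k (σ k)))))
  rw [planted_position he] at hik
  by_cases hi' : ∃ k', e k' (σ k') = i
  · obtain ⟨k', rfl⟩ := hi'
    rw [planted_position he] at hik
    obtain rfl : k' = k := Fin.ext (by omega)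
    exact hi
  · rw [planted_of_ne _ _ _ fun k hk => hi' ⟨k, hk⟩] at hik
    omega

/-- The background shares type `0` with the first planted index and so adds no type. -/
theorem numTypes_planted_pair (hm : 0 < m) :
    numTypes (fun j => (planted e (fun k => ((0 : ℕ∞), (k : ℕ))) (1, 0) σ j).2) = m := by
  have : Finset.univ.image (fun j => (planted e (fun k => ((0 : ℕ∞), (k : ℕ))) (1, 0) σ j).2) =
      Finset.range m := by
    ext t
    simp only [Finset.mem_image, Finset.mem_univ, true_and, Finset.mem_range]
    constructor
    · rintro ⟨j, rfl⟩
      by_cases hj : ∃ k, e k (σ k) = j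
      · obtain ⟨k, rfl⟩ := hj
        rw [planted_position he]
        exact k.2
      · rwa [planted_of_ne _ _ _ fun k hk => hj ⟨k, hk⟩]
    · exact fun ht => ⟨_, congrArg Prod.snd
        (planted_position he (fun k : Fin m => ((0 : ℕ∞), (k : ℕ))) (1, 0) σ ⟨t, ht⟩)⟩
  rw [numTypes, this, Finset.card_range]

theorem positions_subset_of_isSmallestDifferentType (hm : 0 < m) {d' : ℕ} (hd' : m ≤ d')
    {I : Finset (Fin N)}
    (h : IsSmallestDifferentType d'
      (fun j => (planted e (fun k => ((0 : ℕ∞), (k : ℕ))) (1, 0) σ j).1)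
      (fun j => (planted e (fun k => ((0 : ℕ∞), (k : ℕ))) (1, 0) σ j).2) I) :
    positions e σ ⊆ I ∧ I.card ≤ m := by
  have hc : I.card = m := by rw [h.1.1, numTypes_planted_pair he σ hm, min_eq_right hd']
  refine ⟨?_, hc.le⟩
  by_contra hI
  obtain ⟨j, hj, hjI, i, hi, hiS⟩ := exists_mem_sdiff_of_not_subset
    (hc.trans ((card_positions he σ).trans (Fintype.card_fin m)).symm) hI
  obtain ⟨k, rfl⟩ := mem_positions.1 hj
  have hlt := h.2 _ hjI i hi
  dsimp only at hlt
  rw [planted_position he, planted_of_ne _ _ _ fun k hk => hiS (mem_positions.2 ⟨k, hk⟩)] at hlt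
  -- The value `0` occurs only at planted positions, whose types differ, so `i'` would be the missed
  -- position itself.
  obtain ⟨i', hi', hg, hf⟩ := hlt (by simp)
  by_cases hi'' : ∃ k', e k' (σ k') = i'
  · obtain ⟨k', rfl⟩ := hi''
    rw [planted_position he] at hg
    obtain rfl : k' = k := Fin.ext hg
    exact hjI hi'
  · rw [planted_of_ne _ _ _ fun k hk => hi'' ⟨k, hk⟩] at hf
    simp at hf

end types

/-- There are `(N / m) ^ m` planted inputs; `numQueries_pos` needs twice the two that can share an
output. -/
theorem four_le_div_pow {m : ℕ} (hm : 0 < m) (h : 2 * (m + 1) ≤ N) : 4 ≤ (N / m) ^ m := by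
  obtain rfl | hm2 : m = 1 ∨ 2 ≤ m := by omega
  · simp; omega
  · have hL : 2 ≤ N / m := (Nat.le_div_iff_mul_le hm).2 (by omega)
    calc 4 = 2 ^ 2 := rfl
      _ ≤ 2 ^ m := Nat.pow_le_pow_right (by omega) hm2
      _ ≤ (N / m) ^ m := Nat.pow_le_pow_left hL m

theorem nonempty_block {m : ℕ} (hm : 0 < m) (h : m ≤ N) : Nonempty (Fin (N / m)) :=
  ⟨⟨0, Nat.div_pos h hm⟩⟩

/-! ### The three lower bounds -/

section bounds

variable {ε : ℝ} (hε₀ : 0 ≤ ε) (hε : ε < 1 / 2)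

include hε in
theorem one_sub_two_sqrt_pos : 0 < 1 - 2 * √(ε * (1 - ε)) := by
  have : √(ε * (1 - ε)) < 1 / 2 := (Real.sqrt_lt' (by norm_num)).2 (by nlinarith)
  linarith

include hε₀ hε

theorem smallest_bound {d : ℕ} (hd : 0 < d) (hN : 2 * d ≤ N)
    (P : QueryAlgorithm (Fin N) ℕ∞ (Finset (Fin N)))
    (hP : P.Solves ε Set.univ fun f I => IsSmallest d f I) :
    (1 - 2 * √(ε * (1 - ε))) / 12 * √((d : ℝ) * N) ≤ P.numQueries := by
  have := nonempty_block (N := N) hd (by omega)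
  have he := injective2_blockPosition (N := N) (m := d)
  have := search_bound he (fun _ => 0) 1 P hε₀ hε (fun σ => {z | IsSmallest d _ z})
    (fun σ => hP _ trivial) 0 fun σ z hz => ⟨positions_subset_of_isSmallest he
      (by simpa using hz), by simpa using hz.1.le⟩
  simp only [Fintype.card_fin] at this
  exact sqrt_le_of_search_bound (one_sub_two_sqrt_pos hε) hd hN (by omega) (by omega)
    (Or.inl rfl) this

theorem differentType_bound {d d' : ℕ} (hd : 2 ≤ d) (hN : 2 * d ≤ N) (hd' : d ≤ d')
    (P : QueryAlgorithm (Fin N) ℕ (Finset (Fin N)))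
    (hP : P.Solves ε {g | min d' (numTypes g) = d} fun g I => IsDifferentType d' g I) :
    (1 - 2 * √(ε * (1 - ε))) / 12 * √((d : ℝ) * N) ≤ P.numQueries := by
  -- One of the `d` types is that of the background. For `d = 1` any single index is correct, and no
  -- query is needed.
  obtain ⟨m, rfl⟩ : ∃ m, d = m + 1 := ⟨d - 1, by omega⟩
  have hm : 0 < m := by omega
  have := nonempty_block (N := N) hm (by omega)
  have he := injective2_blockPosition (N := N) (m := m)
  let x := planted (blockPosition : Fin m → Fin (N / m) → Fin N) (fun k => (k : ℕ) + 1) 0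
  have hG : ∀ σ, 1 - ε ≤ P.outputProb (x σ) {z | IsDifferentType d' (x σ) z} := fun σ =>
    hP _ (by
      change min d' (numTypes (x σ)) = m + 1
      rw [numTypes_planted_succ he σ (by omega), min_eq_right hd'])
  have hD : ∀ σ, ∀ z ∈ {z | IsDifferentType d' (x σ) z},
      positions blockPosition σ ⊆ z ∧ z.card ≤ Fintype.card (Fin m) + 1 := fun σ z hz => by
    simpa using positions_subset_of_isDifferentType he σ (by omega) hd' hz
  -- Since `D = 1`, the adversary bound can be void when `m` and `N / m` are small, so zero queries
  -- are excluded separately.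
  have hT : 1 ≤ P.numQueries := by
    refine P.numQueries_pos Finset.univ hε x _ (fun σ _ => hG σ) 2 (fun z s _ hs => ?_)
      Finset.univ_nonempty (by simpa using four_le_div_pow hm hN)
    rcases s.eq_empty_or_nonempty with rfl | ⟨σ, hσ⟩
    · simp
    · exact card_le_two_of_positions_subset he (hD σ z (hs σ hσ)).2 s
        fun τ hτ => (hD τ z (hs τ hτ)).1
  have := search_bound he _ _ P hε₀ hε _ hG 1 hD
  simp only [Fintype.card_fin] at this
  exact sqrt_le_of_search_bound (one_sub_two_sqrt_pos hε) hm (by omega) (by omega) le_rfl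
    (Or.inr hT) this

theorem smallestDifferentType_bound {d d' : ℕ} (hd : 0 < d) (hN : 2 * d ≤ N) (hd' : d ≤ d')
    (P : QueryAlgorithm (Fin N) (ℕ∞ × ℕ) (Finset (Fin N)))
    (hP : P.Solves ε {x | min d' (numTypes fun j => (x j).2) = d}
      fun x I => IsSmallestDifferentType d' (fun j => (x j).1) (fun j => (x j).2) I) :
    (1 - 2 * √(ε * (1 - ε))) / 12 * √((d : ℝ) * N) ≤ P.numQueries := by
  have := nonempty_block (N := N) hd (by omega)
  have he := injective2_blockPosition (N := N) (m := d)
  let x := planted (blockPosition : Fin d → Fin (N / d) → Fin N)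
    (fun k => ((0 : ℕ∞), (k : ℕ))) (1, 0)
  have hG : ∀ σ, 1 - ε ≤ P.outputProb (x σ)
      {z | IsSmallestDifferentType d' (fun j => (x σ j).1) (fun j => (x σ j).2) z} := fun σ =>
    hP _ (by
      change min d' (numTypes fun j => (x σ j).2) = d
      rw [numTypes_planted_pair he σ hd, min_eq_right hd'])
  have := search_bound he _ _ P hε₀ hε _ hG 0 fun σ z hz => by
    simpa using positions_subset_of_isSmallestDifferentType he σ hd hd' hz
  simp only [Fintype.card_fin] at this
  exact sqrt_le_of_search_bound (one_sub_two_sqrt_pos hε) hd hN (by omega) (by omega)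
    (Or.inl rfl) this

end bounds

end QuantumQuery

theorem mainTheorem3 (ε : ℝ) (hε₀ : 0 ≤ ε) (hε : ε < 1 / 2) :
    ∃ c : ℝ, 0 < c ∧ ∀ N d : ℕ, 2 * d ≤ N →
      -- find `d` smallest values of a function
      (∀ P : QuantumQuery.QueryAlgorithm (Fin N) ℕ∞ (Finset (Fin N)),
        P.Solves ε Set.univ (fun f I => QuantumQuery.IsSmallest d f I) →
        c * √((d : ℝ) * N) ≤ P.numQueries) ∧
      -- find `d = min d' e` elements of different type
      (2 ≤ d → ∀ d' : ℕ, d ≤ d' →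
        ∀ P : QuantumQuery.QueryAlgorithm (Fin N) ℕ (Finset (Fin N)),
          P.Solves ε {g | min d' (QuantumQuery.numTypes g) = d}
            (fun g I => QuantumQuery.IsDifferentType d' g I) →
          c * √((d : ℝ) * N) ≤ P.numQueries) ∧
      -- find `d = min d' e` smallest values of different type; a query to `j` returns `f j`
      -- together with `g j`
      (∀ d' : ℕ, d ≤ d' →
        ∀ P : QuantumQuery.QueryAlgorithm (Fin N) (ℕ∞ × ℕ) (Finset (Fin N)),
          P.Solves ε {x | min d' (QuantumQuery.numTypes fun j => (x j).2) = d}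
            (fun x I => QuantumQuery.IsSmallestDifferentType d'
              (fun j => (x j).1) (fun j => (x j).2) I) →
          c * √((d : ℝ) * N) ≤ P.numQueries) := by
  refine ⟨(1 - 2 * √(ε * (1 - ε))) / 12,
    div_pos (QuantumQuery.one_sub_two_sqrt_pos hε) (by norm_num), fun N d hN => ⟨?_, ?_, ?_⟩⟩
  · intro P hP
    rcases d.eq_zero_or_pos with rfl | hd
    · simp
    · exact QuantumQuery.smallest_bound hε₀ hε hd hN P hP
  · exact fun hd d' hd' P hP => QuantumQuery.differentType_bound hε₀ hε hd hN hd' P hP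
  · intro d' hd' P hP
    rcases d.eq_zero_or_pos with rfl | hd
    · simp
    · exact QuantumQuery.smallestDifferentType_bound hε₀ hε hd hN hd' P hP
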